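/- Let $p$ be an odd prime, $n\ge 1$, $d=p^n$, let $\mathbb{F}_d$ be the field with $d$ elements and $\operatorname{tr}\colon\mathbb{F}_d\to\mathbb{Z}_p$ the field trace. Let $\mathcal{H}$ be the $d$-dimensional complex Hilbert space with orthonormal basis $\{|x\rangle : x\in\mathbb{F}_d\}$. Put $\omega=e^{2\pi i/p}$ and $\tau=\omega^{(p+1)/2}$, and for $\mathbf{u}=(u_1,u_2)\in\mathbb{F}_d^2$ let $$D_{\mathbf{u}}=\tau^{\operatorname{tr}(u_1u_2)}X_{u_1}Z_{u_2},\qquad X_u|x\rangle=|x+u\rangle,\qquad Z_u|x\rangle=\omega^{\operatorname{tr}(xu)}|x\rangle .$$ Let $l(x)$ be the quadratic character of $\mathbb{F}_d$ ($1$ on non-zero squares, $-1$ on non-squares, $l(0)=0$), and let $\tilde l(x)=-i^{-n(p+3)/2}\,l(x)$ for $x\ne 0$, $\tilde l(0)=1$. Let $\mathrm{ESL}(2,\mathbb{F}_d)$ be the group of $2\times 2$ matrices over $\mathbb{F}_d$ with determinant $\pm1$. For $F=\begin{pmatrix}\alpha&\beta\\ \gamma&\delta\end{pmatrix}$ with $\det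 F=1$ define $$U_F=\begin{cases} l(\alpha)\sum_{x\in\mathbb{F}_d}\tau^{\operatorname{tr}(\alpha\gamma x^2)}\,|\alpha x\rangle\langle x| & \text{if }\beta=0,\\[4pt] \dfrac{\tilde l(-\beta)}{\sqrt d}\sum_{x,y\in\mathbb{F}_d}\tau^{\operatorname{tr}(\beta^{-1}(\alpha y^2-2xy+\delta x^2))}\,|x\rangle\langle y| & \text{if }\beta\neq0,\end{cases}$$ and for $\det F=-1$ define $U_F=U_{FJ}U_J$, where $J=\begin{pmatrix}1&0\\0&-1\end{pmatrix}$ and $U_J\bigl(\sum_x c_x|x\rangle\bigr)=\sum_x c_x^{*}|x\rangle$. Then for every $F\in\mathrm{ESL}(2,\mathbb{F}_d)$ the operator $U_F$ is unitary if $\det F=1$ and anti-unitary if $\det F=-1$, and: 1. for all $F\in\mathrm{ESL}(2,\mathbb{F}_d)$ and $\mathbf{u}\in\mathbb{F}_d^2$, $\;U_F D_{\mathbf{u}} U_F^{\dagger}=D_{F\mathbf{u}}$; 2. for all $F,F'\in\mathrm{ESL}(2,\mathbb{F}_d)$, $\;U_FU_{F'}=U_{FF'}$ and $U_{F^{-1}}=U_F^{\dagger}$.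 Here $A^\dagger$ is the usual adjoint, $\langle A^\dagger\psi,\phi\rangle=\langle\psi,A\phi\rangle$, when $A$ is linear, and the conjugate-linear adjoint, $\langle A^\dagger\psi,\phi\rangle=\langle\psi,A\phi\rangle^{*}$, when $A$ is conjugate-linear. -/

import Mathlib

noncomputable section

namespace GaloisClifford

/-- The extended symplectic group `ESL(2, K)`: all `2 × 2` matrices over `K` of determinant `±1`. -/
def ESL (K : Type*) [Field K] : Subgroup (Matrix.GeneralLinearGroup (Fin 2) K) where
  carrier := {F | (F : Matrix (Fin 2) (Fin 2) K).det = 1 ∨ (F : Matrix (Fin 2) (Fin 2) K).det = -1}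
  one_mem' := by simp
  mul_mem' := by
    rintro F G (hF | hF) (hG | hG) <;> simp [hF, hG]
  inv_mem' := by
    rintro F (hF | hF) <;> simp [Matrix.det_nonsing_inv, hF]

/-- The anti-symplectic matrix `J = diag(1, -1)`. -/
def J (K : Type*) [Field K] : Matrix (Fin 2) (Fin 2) K := !![1, 0; 0, -1]

/-- `ω = e^{2πi/p}`. -/
def omega (p : ℕ) : ℂ := Complex.exp (2 * Real.pi * Complex.I / p)

/-- `τ = ω^{(p+1)/2}` (`p` is odd, so the division is exact). -/
def tau (p : ℕ) : ℂ := omega p ^ ((p + 1) / 2)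

/-- `ω^{tr x}`, with `tr : K → ℤ/p` the field trace. The exponent is the representative of `tr x`
in `{0, …, p-1}`; as `ω^p = 1` any other representative gives the same value. -/
def omegaTr (p : ℕ) {K : Type*} [Field K] [Algebra (ZMod p) K] (x : K) : ℂ :=
  omega p ^ (Algebra.trace (ZMod p) K x).val

/-- `τ^{tr x}`, with the same convention; here too `τ^p = 1`. -/
def tauTr (p : ℕ) {K : Type*} [Field K] [Algebra (ZMod p) K] (x : K) : ℂ :=
  tau p ^ (Algebra.trace (ZMod p) K x).val

/-- The quadratic character `l` of `K`: `1` on nonzero squares, `-1` on non-squares, `0` at `0`. -/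
def ell {K : Type*} [Field K] [Fintype K] [DecidableEq K] (x : K) : ℂ :=
  ((quadraticChar K x : ℤ) : ℂ)

/-- `l̃(x) = -i^{-n(p+3)/2} l(x)` for `x ≠ 0` and `l̃(0) = 1`
(`p` is odd, so the division in the exponent is exact). -/
def ellTilde (p n : ℕ) {K : Type*} [Field K] [Fintype K] [DecidableEq K] (x : K) : ℂ :=
  if x = 0 then 1 else -(Complex.I ^ (-((n * (p + 3) / 2 : ℕ) : ℤ))) * ell x

/-- The `d`-dimensional Hilbert space, with orthonormal basis `|x⟩` labelled by `x ∈ K`. -/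
abbrev Hilb (K : Type*) [Fintype K] : Type _ := EuclideanSpace ℂ K

/-- Real-linear operators on the Hilbert space, with composition as product. This ring contains
both the (complex) linear and the conjugate-linear operators. -/
abbrev Op (K : Type*) [Fintype K] : Type _ := Module.End ℝ (Hilb K)

/-- The operator `∑_{x,y} M_{xy} |x⟩⟨y|`. -/
def ofMatrix {K : Type*} [Fintype K] [DecidableEq K] (M : Matrix K K ℂ) : Op K :=
  (Matrix.toEuclideanLin M).restrictScalars ℝ

/-- The matrix of `X_u`, `X_u |x⟩ = |x + u⟩`. -/
def matX {K : Type*} [Field K] [DecidableEq K] (u : K) : Matrix K K ℂ :=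
  Matrix.of fun x y => if x = y + u then 1 else 0

/-- The matrix of `Z_u`, `Z_u |x⟩ = ω^{tr(xu)} |x⟩`. -/
def matZ (p : ℕ) {K : Type*} [Field K] [DecidableEq K] [Algebra (ZMod p) K] (u : K) :
    Matrix K K ℂ :=
  Matrix.diagonal fun x => omegaTr p (x * u)

/-- The displacement operator `D_u = τ^{tr(u₁u₂)} X_{u₁} Z_{u₂}`. -/
def D (p : ℕ) {K : Type*} [Field K] [Fintype K] [DecidableEq K] [Algebra (ZMod p) K]
    (u : Fin 2 → K) : Op K :=
  ofMatrix (tauTr p (u 0 * u 1) • (matX (u 0) * matZ p (u 1)))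

/-- The matrix of `U_F` for `F = !![α, β; γ, δ]` of determinant `1`:
`l(α) ∑_x τ^{tr(αγx²)} |αx⟩⟨x|` if `β = 0`, and
`(l̃(-β)/√d) ∑_{x,y} τ^{tr(β⁻¹(αy² - 2xy + δx²))} |x⟩⟨y|` if `β ≠ 0`, where `d = p^n`. -/
def matU (p n : ℕ) {K : Type*} [Field K] [Fintype K] [DecidableEq K] [Algebra (ZMod p) K]
    (F : Matrix (Fin 2) (Fin 2) K) : Matrix K K ℂ :=
  if F 0 1 = 0 then
    Matrix.of fun x y =>
      if x = F 0 0 * y then ell (F 0 0) * tauTr p (F 0 0 * F 1 0 * y ^ 2) else 0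
  else
    Matrix.of fun x y =>
      ellTilde p n (-(F 0 1)) / (Real.sqrt ((p : ℝ) ^ n) : ℂ) *
        tauTr p ((F 0 1)⁻¹ * (F 0 0 * y ^ 2 - 2 * x * y + F 1 1 * x ^ 2))

/-- `U_J`: complex conjugation of the coefficients in the standard basis. -/
def UJ (K : Type*) [Fintype K] : Op K where
  toFun ψ := WithLp.toLp 2 fun x => (starRingEnd ℂ) (ψ x)
  map_add' ψ φ := by ext x; simp
  map_smul' c ψ := by ext x; simp

/-- `U_F` for `F ∈ ESL(2, K)`: the operator with matrix `matU F` if `det F = 1`, and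
`U_F = U_{FJ} U_J` if `det F = -1`. -/
def U (p n : ℕ) {K : Type*} [Field K] [Fintype K] [DecidableEq K] [Algebra (ZMod p) K]
    (F : ESL K) : Op K :=
  if ((F : Matrix.GeneralLinearGroup (Fin 2) K) : Matrix (Fin 2) (Fin 2) K).det = 1 then
    ofMatrix (matU p n ((F : Matrix.GeneralLinearGroup (Fin 2) K) : Matrix (Fin 2) (Fin 2) K))
  else
    ofMatrix (matU p n
      (((F : Matrix.GeneralLinearGroup (Fin 2) K) : Matrix (Fin 2) (Fin 2) K) * J K)) * UJ K

/-- `A` is unitary: complex linear, onto, and inner-product preserving. -/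
def IsUnitaryOp {K : Type*} [Fintype K] (A : Op K) : Prop :=
  (∀ (c : ℂ) (ψ : Hilb K), A (c • ψ) = c • A ψ) ∧
    Function.Surjective A ∧ ∀ ψ φ : Hilb K, inner ℂ (A ψ) (A φ) = inner ℂ ψ φ

/-- `A` is anti-unitary: conjugate-linear, onto, and conjugating inner products. -/
def IsAntiUnitaryOp {K : Type*} [Fintype K] (A : Op K) : Prop :=
  (∀ (c : ℂ) (ψ : Hilb K), A (c • ψ) = (starRingEnd ℂ) c • A ψ) ∧
    Function.Surjective A ∧
      ∀ ψ φ : Hilb K, inner ℂ (A ψ) (A φ) = (starRingEnd ℂ) (inner ℂ ψ φ)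

/-- The adjoint `A†`, taken with respect to the real inner product `Re ⟨ψ, φ⟩`. For complex-linear
`A` it is the usual adjoint, `⟨A†ψ, φ⟩ = ⟨ψ, Aφ⟩`, and for conjugate-linear `A` it is the usual
conjugate-linear adjoint, `⟨A†ψ, φ⟩ = ⟨ψ, Aφ⟩*`; both facts are proved below. -/
def dagger {K : Type*} [Fintype K] (A : Op K) : Op K := LinearMap.adjoint A

theorem real_inner_eq_re {K : Type*} [Fintype K] (ψ φ : Hilb K) :
    inner ℝ ψ φ = (inner ℂ ψ φ : ℂ).re := by
  simp [PiLp.inner_apply]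

theorem re_inner_dagger {K : Type*} [Fintype K] (A : Op K) (ψ φ : Hilb K) :
    (inner ℂ (dagger A ψ) φ : ℂ).re = (inner ℂ ψ (A φ) : ℂ).re := by
  rw [← real_inner_eq_re, ← real_inner_eq_re]
  exact LinearMap.adjoint_inner_left A φ ψ

theorem inner_dagger_of_linear {K : Type*} [Fintype K] (A : Op K)
    (hA : ∀ (c : ℂ) (ψ : Hilb K), A (c • ψ) = c • A ψ) (ψ φ : Hilb K) :
    inner ℂ (dagger A ψ) φ = inner ℂ ψ (A φ) := by
  apply Complex.ext (re_inner_dagger A ψ φ)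
  have h := re_inner_dagger A ψ (Complex.I • φ)
  rw [hA, inner_smul_right, inner_smul_right] at h
  simpa using h

theorem inner_dagger_of_conjLinear {K : Type*} [Fintype K] (A : Op K)
    (hA : ∀ (c : ℂ) (ψ : Hilb K), A (c • ψ) = (starRingEnd ℂ) c • A ψ) (ψ φ : Hilb K) :
    inner ℂ (dagger A ψ) φ = (starRingEnd ℂ) (inner ℂ ψ (A φ)) := by
  apply Complex.ext
  · rw [Complex.conj_re, re_inner_dagger]
  have h := re_inner_dagger A ψ (Complex.I • φ)
  rw [hA, inner_smul_right, inner_smul_right] at h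
  rw [Complex.conj_im]
  simp only [Complex.mul_re, Complex.mul_im, Complex.conj_re, Complex.conj_im, Complex.I_re,
    Complex.I_im] at h
  linarith

end GaloisClifford

end

/-!
For determinant `1` the operators `U_F` form the Weil representation of `SL(2, K)`. Relative to
the additive character `ψ(x) = τ ^ tr x`, each `U_F` is given either by a monomial matrix (`β = 0`)
or by a Gaussian kernel `ψ(quadratic form)` (`β ≠ 0`).

The identity `U_F U_G = U_{FG}` is an entrywise computation (`matU_mul`): when neither factor is
lower triangular, the sum over the intermediate index is a quadratic exponential sum, evaluated by
completing the square. The scalar factors match exactly when the phase `-i^{-n(p+3)/2}` equals the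
normalised quadratic Gauss sum `d^{-1/2} ∑ ψ(x²)`. Its square is elementary, but its sign has to be
determined as well (`sum_tauTr_sq_eq_phase`), in two steps.

* Prime field (`gaussSum_tauChar`): the Gauss sum of `ω` is `±∏ (ω^k - ω^{-k})`, the product over
  `1 ≤ k ≤ (p - 1) / 2`, because both have the same square. The product is `i^{(p-1)/2}` times a
  positive real. The sign is found modulo the prime above `p` (`sign_congruence`): in
  `𝔽_p[X] / (X - 1)^{p-1}` both sides vanish to order `(p - 1) / 2` at `X = 1`, and the leading
  coefficients are compared using Wilson's theorem.
* Extension (`sum_tauTr_sq`): in a basis of `K` orthogonal for the trace form the sum over `K`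
  factors into sums over the prime field. The product of the resulting quadratic characters is that
  of the discriminant of the trace form; as Frobenius permutes the conjugates in an `n`-cycle, it is
  `(-1)^{n-1}` (`prod_ell_trace_basis`).

Unitarity follows from multiplicativity together with `(matU F)ᴴ = matU F⁻¹`; covariance
`U_F D_u = D_{Fu} U_F` is a direct comparison of entries (`matU_mul_matD`). Determinant `-1` reduces
to determinant `1`, since complex conjugation of coefficients implements conjugation by `J`
(`map_conj_matU`, `map_conj_matD`).
-/

namespace GaloisClifford

/-! ### The Euler operator on polynomials -/

section Euler

open Polynomial

/-- The Euler operator `f ↦ X * f'` on polynomials; it multiplies `X ^ j` by `j`. -/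
noncomputable def eulerOp (R : Type*) [CommRing R] : Module.End R R[X] :=
  LinearMap.mulLeft R X ∘ₗ derivative

theorem eulerOp_apply {R : Type*} [CommRing R] (f : R[X]) :
    eulerOp R f = X * derivative f := rfl

theorem eulerOp_pow_X_pow {R : Type*} [CommRing R] (m j : ℕ) :
    (eulerOp R ^ m) (X ^ j) = ((j : R) ^ m) • (X ^ j : R[X]) := by
  induction m with
  | zero => simp
  | succ m ih =>
    rw [pow_succ', Module.End.mul_apply, ih, map_smul, eulerOp_apply, derivative_X_pow]
    rcases j with _ | j
    · simp
    · rw [smul_eq_C_mul, smul_eq_C_mul, pow_succ _ m, C_mul, Nat.add_sub_cancel]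
      ring

/-- The `m`-th iterate of the Euler operator reads off the leading coefficient at `1` of a
polynomial vanishing there to order `m`. -/
theorem eval_one_eulerOp_pow {R : Type*} [CommRing R] (m : ℕ) (h : R[X]) :
    eval 1 ((eulerOp R ^ m) ((X - 1) ^ m * h)) = m.factorial * eval 1 h := by
  induction m generalizing h with
  | zero => simp
  | succ m ih =>
    have key : eulerOp R ((X - 1) ^ (m + 1) * h) =
        (X - 1) ^ m * (((m + 1 : ℕ) : R[X]) * X * h + (X - 1) * X * derivative h) := by
      rw [eulerOp_apply, derivative_mul, derivative_pow]
      simp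
      ring
    rw [pow_succ, Module.End.mul_apply, key, ih]
    simp [Nat.factorial_succ]
    ring

theorem exists_X_pow_sub_X_pow_eq {R : Type*} [CommRing R] (a b : ℕ) :
    ∃ h : R[X], (X ^ a - X ^ b : R[X]) = (X - 1) * h ∧ eval 1 h = (a : R) - b := by
  have hd : (X - C 1 : R[X]) ∣ X ^ a - X ^ b := by
    rw [dvd_iff_isRoot]; simp [IsRoot]
  obtain ⟨h, hh⟩ := hd
  refine ⟨h, by simpa using hh, ?_⟩
  have := congrArg (fun f => eval 1 (derivative f)) hh
  simpa [derivative_X_pow] using this.symm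

end Euler

/-! ### The product `∏ (ζ ^ k - ζ ^ (-k))` -/

/-- Up to the factors `-1`, the square is `∏ (1 - η ^ j) = p` over `1 ≤ j ≤ p - 1`, where
`η = ζ ^ 2`. -/
theorem prod_sub_inv_sq {p m : ℕ} (hm : p = 2 * m + 1) {ζ : ℂ}
    (hζ : IsPrimitiveRoot ζ p) :
    (∏ k ∈ Finset.range m, (ζ ^ (k + 1) - ζ ^ (p - (k + 1)))) ^ 2 = (-1) ^ m * p := by
  have hη : IsPrimitiveRoot (ζ ^ 2) p := by
    refine hζ.pow_of_coprime 2 ?_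
    rw [Nat.coprime_two_left, hm]; exact odd_two_mul_add_one m
  have h1 : ∏ k ∈ Finset.range (m + m), (1 - (ζ ^ 2) ^ (k + 1)) = (p : ℂ) := by
    have := (show IsPrimitiveRoot (ζ ^ 2) (2 * m + 1) from hm ▸ hη).prod_one_sub_pow_eq_order
    rw [← two_mul, this, hm]; push_cast; ring
  rw [Finset.prod_range_add, ← Finset.prod_range_reflect (fun x => 1 - (ζ ^ 2) ^ (m + x + 1)),
    ← Finset.prod_mul_distrib] at h1
  rw [← h1, ← Finset.prod_pow, ← Finset.card_range m, ← Finset.prod_const, Finset.card_range,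
    ← Finset.prod_mul_distrib]
  refine Finset.prod_congr rfl fun k hk => ?_
  have hk' := Finset.mem_range.1 hk
  have e1 : m + (m - 1 - k) + 1 = p - (k + 1) := by omega
  have e2 : ζ ^ (k + 1) * ζ ^ (p - (k + 1)) = 1 := by
    rw [← pow_add, show k + 1 + (p - (k + 1)) = p by omega, hζ.pow_eq_one]
  rw [e1, ← pow_mul, mul_comm 2, pow_mul, ← pow_mul ζ 2, mul_comm 2, pow_mul]
  linear_combination (ζ ^ (k + 1) * ζ ^ (p - (k + 1)) - 1) * e2

section Prime

open Polynomial

variable {p m : ℕ} [Fact p.Prime]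

theorem sum_zmod_eq_sum_range {M : Type*} [AddCommMonoid M] (f : ZMod p → M) :
    ∑ x, f x = ∑ j ∈ Finset.range p, f (j : ZMod p) := by
  symm
  refine Finset.sum_bij' (fun j _ => (j : ZMod p)) (fun x _ => x.val) ?_ ?_ ?_ ?_ ?_
  · simp
  · intro x _; simpa using ZMod.val_lt x
  · intro j hj; exact ZMod.val_cast_of_lt (Finset.mem_range.1 hj)
  · intro x _; simp
  · simp

/-- Wilson's theorem, with the factors `j` and `p - j` paired. -/
theorem factorial_half_sq (hm : p = 2 * m + 1) :
    ((m.factorial : ZMod p)) ^ 2 = (-1) ^ (m + 1) := by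
  have hW := ZMod.wilsons_lemma p
  have h2 : p - 1 = m + m := by omega
  have hp0 : ((2 * m + 1 : ℕ) : ZMod p) = 0 := by rw [← hm]; simp
  rw [h2, ← Finset.prod_range_add_one_eq_factorial, Finset.prod_range_add,
    Finset.prod_range_add_one_eq_factorial] at hW
  have h3 : ((∏ x ∈ Finset.range m, (m + x + 1) : ℕ) : ZMod p) = (-1) ^ m * m.factorial := by
    rw [← Finset.prod_range_reflect, ← Finset.prod_range_add_one_eq_factorial]
    push_cast
    rw [← Finset.card_range m, ← Finset.prod_const, Finset.card_range, ← Finset.prod_mul_distrib]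
    refine Finset.prod_congr rfl fun j hj => ?_
    have : m + (m - 1 - j) + 1 + (j + 1) = 2 * m + 1 := by
      have := Finset.mem_range.1 hj; omega
    have h4 : ((m + (m - 1 - j) + 1 + (j + 1) : ℕ) : ZMod p) = 0 := by rw [this, hp0]
    push_cast at h4
    linear_combination h4
  rw [Nat.cast_mul, h3] at hW
  have h5 : ((-1 : ZMod p) ^ m) ^ 2 = 1 := by rw [← pow_mul, mul_comm, pow_mul]; simp
  linear_combination (-1) ^ m * hW - (m.factorial : ZMod p) ^ 2 * h5

theorem sum_pow_sub_one (hm : p = 2 * m + 1) :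
    ∑ j ∈ Finset.range p, (j : ZMod p) ^ m * (j : ZMod p) ^ m = -1 := by
  have hm0 : 0 < m := by
    have := (Fact.out : p.Prime).two_le; omega
  rw [← sum_zmod_eq_sum_range (fun x : ZMod p => x ^ m * x ^ m)]
  rw [← Finset.sum_erase_add _ _ (Finset.mem_univ (0 : ZMod p))]
  have : ∀ x ∈ Finset.univ.erase (0 : ZMod p), x ^ m * x ^ m = 1 := by
    intro x hx
    rw [← pow_add, show m + m = p - 1 by omega]
    exact ZMod.pow_card_sub_one_eq_one (Finset.ne_of_mem_erase hx)
  rw [Finset.sum_congr rfl this, zero_pow hm0.ne']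
  simp [Finset.card_erase_of_mem, (Fact.out : p.Prime).one_le]

theorem quadraticChar_cast_eq_pow (hm : p = 2 * m + 1) (x : ZMod p) :
    ((quadraticChar (ZMod p) x : ℤ) : ZMod p) = x ^ m := by
  have := quadraticChar_eq_pow_of_char_ne_two' (F := ZMod p)
    (by rw [ZMod.ringChar_zmod_n]; omega) x
  rw [this, ZMod.card, show p / 2 = m by omega]

/-- Comparison of the quadratic Gauss sum with the product `∏ (ζ ^ k - ζ ^ (-k))` modulo the prime
`1 - ζ`: in `ℤ[ζ]/p = 𝔽_p[X]/(X - 1) ^ (p - 1)` both vanish to order `m = (p - 1) / 2` at `X = 1`,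
and the leading coefficients are read off by the Euler operator. -/
theorem sign_congruence (hm : p = 2 * m + 1) {ζ : ℂ} (hζ : IsPrimitiveRoot ζ p) (ε : ℤ)
    (h : ∑ j ∈ Finset.range p, ((quadraticChar (ZMod p) (j : ZMod p) : ℤ) : ℂ) * ζ ^ j =
      ε * ∏ k ∈ Finset.range m, (ζ ^ (k + 1) - ζ ^ (p - (k + 1)))) :
    (ε : ZMod p) * (2 ^ m * (m.factorial : ZMod p) ^ 2) = -1 := by
  have hp : p.Prime := Fact.out
  have hm0 : 0 < m := by have := hp.two_le; omega
  set f : ℤ[X] := ∑ j ∈ Finset.range p, C (quadraticChar (ZMod p) (j : ZMod p)) * X ^ j -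
    C ε * ∏ k ∈ Finset.range m, (X ^ (k + 1) - X ^ (p - (k + 1))) with hf
  have hroot : aeval ζ f = 0 := by
    simp [hf, map_sum, map_prod, h, -quadraticChar_apply]
  have hdvd : cyclotomic p ℤ ∣ f := by
    rw [cyclotomic_eq_minpoly hζ hp.pos]
    exact minpoly.isIntegrallyClosed_dvd (hζ.isIntegral hp.pos) hroot
  have hdvd2 : (X - 1 : (ZMod p)[X]) ^ (m + 1) ∣ f.map (Int.castRingHom (ZMod p)) := by
    have h1 := Polynomial.map_dvd (Int.castRingHom (ZMod p)) hdvd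
    rw [map_cyclotomic] at h1
    have h2 : cyclotomic p (ZMod p) = (X - 1) ^ (p - 1) := by
      have := cyclotomic_mul_prime_eq_pow_of_not_dvd (ZMod p) (p := p) (n := 1)
        (by simpa using hp.one_lt.ne')
      simpa using this
    rw [h2] at h1
    -- `p - 1 = 2 m ≥ m + 1`
    exact (pow_dvd_pow _ (by omega)).trans h1
  obtain ⟨q, hq⟩ := hdvd2
  choose g hg hg1 using fun k : ℕ => exists_X_pow_sub_X_pow_eq (R := ZMod p) (k + 1) (p - (k + 1))
  have hmap : f.map (Int.castRingHom (ZMod p)) =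
      ∑ j ∈ Finset.range p, ((j : ZMod p) ^ m) • (X ^ j : (ZMod p)[X]) -
        (X - 1) ^ m * (C (ε : ZMod p) * ∏ k ∈ Finset.range m, g k) := by
    rw [hf, Polynomial.map_sub, Polynomial.map_sum, Polynomial.map_mul, Polynomial.map_prod]
    congr 1
    · refine Finset.sum_congr rfl fun j _ => ?_
      rw [← quadraticChar_cast_eq_pow hm]
      simp [smul_eq_C_mul, -quadraticChar_apply]
    · have : ∏ k ∈ Finset.range m, map (Int.castRingHom (ZMod p)) (X ^ (k + 1) - X ^ (p - (k + 1)))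
          = (X - 1) ^ m * ∏ k ∈ Finset.range m, g k := by
        rw [← Finset.card_range m, ← Finset.prod_const, Finset.card_range,
          ← Finset.prod_mul_distrib]
        refine Finset.prod_congr rfl fun k _ => ?_
        rw [← hg k]; simp
      rw [this]; simp; ring
  -- Apply the `m`-th power of the Euler operator and evaluate at `1`: the multiple `q` drops out.
  have e1 := congrArg (fun r => eval 1 ((eulerOp (ZMod p) ^ m) r)) (hmap.symm.trans hq)
  simp only [pow_succ (X - 1 : (ZMod p)[X]) m, mul_assoc, map_sub, eval_sub,
    eval_one_eulerOp_pow, map_sum, map_smul, eulerOp_pow_X_pow] at e1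
  simp only [eval_finsetSum, eval_smul, eval_pow, eval_X, one_pow, smul_eq_mul, mul_one,
    sum_pow_sub_one hm, eval_mul, eval_C, eval_sub, eval_one, sub_self, zero_mul, mul_zero,
    eval_prod, hg1] at e1
  have e2 : ∏ k ∈ Finset.range m, (((k + 1 : ℕ) : ZMod p) - ((p - (k + 1) : ℕ) : ZMod p)) =
      2 ^ m * m.factorial := by
    rw [← Finset.prod_range_add_one_eq_factorial, ← Finset.card_range m, ← Finset.prod_const,
      Finset.card_range]
    push_cast
    rw [← Finset.prod_mul_distrib]
    refine Finset.prod_congr rfl fun k hk => ?_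
    have := Finset.mem_range.1 hk
    rw [Nat.cast_sub (by omega)]
    simp; ring
  rw [e2] at e1
  linear_combination -e1

theorem omega_primitive : IsPrimitiveRoot (omega p) p :=
  Complex.isPrimitiveRoot_exp p (Fact.out : p.Prime).ne_zero

/-- The product `∏ (ω ^ k - ω ^ (-k))` with its sign: the factors are `2 i sin (2 π k / p)`, and the
sines are positive as `2 k < p`. -/
theorem prod_omega (hm : p = 2 * m + 1) :
    ∏ k ∈ Finset.range m, (omega p ^ (k + 1) - omega p ^ (p - (k + 1))) =
      Complex.I ^ m * (Real.sqrt p : ℝ) := by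
  have hp : p.Prime := Fact.out
  have hp0 : (0 : ℝ) < p := by exact_mod_cast hp.pos
  have hsq := prod_sub_inv_sq hm (omega_primitive (p := p))
  have h1 : ∀ k ∈ Finset.range m, omega p ^ (k + 1) - omega p ^ (p - (k + 1)) =
      Complex.I * ((2 * Real.sin (2 * Real.pi * (k + 1) / p) : ℝ) : ℂ) := by
    intro k hk
    have hk' := Finset.mem_range.1 hk
    have e2 : omega p ^ (p - (k + 1)) = (omega p ^ (k + 1))⁻¹ := by
      apply eq_inv_of_mul_eq_one_left
      rw [← pow_add, show p - (k + 1) + (k + 1) = p by omega, omega_primitive.pow_eq_one]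
    have e3 : omega p ^ (k + 1) =
        Complex.exp (((2 * Real.pi * (k + 1) / p : ℝ) : ℂ) * Complex.I) := by
      rw [omega, ← Complex.exp_nat_mul]; congr 1; push_cast; ring
    rw [e2, e3, ← Complex.exp_neg, ← neg_mul, Complex.exp_mul_I, Complex.exp_mul_I,
      Complex.cos_neg, Complex.sin_neg]
    push_cast; ring
  rw [Finset.prod_congr rfl h1, Finset.prod_mul_distrib, Finset.prod_const, Finset.card_range,
    ← Complex.ofReal_prod] at hsq ⊢
  set R := ∏ k ∈ Finset.range m, (2 * Real.sin (2 * Real.pi * (k + 1) / p)) with hR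
  have hRpos : 0 < R := by
    refine Finset.prod_pos fun k hk => ?_
    have hk' := Finset.mem_range.1 hk
    have : (2 : ℝ) * (k + 1) < p := by exact_mod_cast (by omega : 2 * (k + 1) < p)
    refine mul_pos two_pos (Real.sin_pos_of_pos_of_lt_pi (by positivity) ?_)
    rw [div_lt_iff₀ hp0]
    nlinarith [Real.pi_pos]
  congr 2
  rw [mul_pow, ← pow_mul, mul_comm m, pow_mul, Complex.I_sq] at hsq
  have h2 : ((R ^ 2 : ℝ) : ℂ) = ((p : ℝ) : ℂ) := by
    push_cast; exact mul_left_cancel₀ (pow_ne_zero _ (by norm_num)) hsq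
  rw [← Complex.ofReal_injective h2, Real.sqrt_sq hRpos.le]

end Prime

theorem addChar_map_sum {A M ι : Type*} [AddCommMonoid A] [CommMonoid M] (ψ : AddChar A M)
    (s : Finset ι) (f : ι → A) : ψ (∑ i ∈ s, f i) = ∏ i ∈ s, ψ (f i) :=
  map_prod ψ.toMonoidHom (fun i => Multiplicative.ofAdd (f i)) s

/-! ### Gauss sums of the quadratic character -/

section GaussSum

variable {F : Type*} [Field F] [Fintype F] [DecidableEq F]

/-- The quadratic character of a finite field, as a complex-valued multiplicative character. -/
noncomputable def quadChar (F : Type*) [Field F] [Fintype F] [DecidableEq F] : MulChar F ℂ :=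
  (quadraticChar F).ringHomComp (Int.castRingHom ℂ)

theorem quadChar_apply (x : F) : quadChar F x = ell x := rfl

theorem ell_mul (x y : F) : ell (x * y) = ell x * ell y := by
  rw [← quadChar_apply, map_mul]; rfl

theorem ell_mul_self {x : F} (hx : x ≠ 0) : ell x * ell x = 1 := by
  rw [← ell_mul, ell, ← sq, quadraticChar_sq_one' hx]; simp

theorem ell_inv {x : F} : ell x⁻¹ = ell x := by
  by_cases hx : x = 0
  · simp [hx]
  · have h := ell_mul_self hx
    have h2 : ell x * ell x⁻¹ = 1 := by rw [← ell_mul, mul_inv_cancel₀ hx]; simp [ell]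
    exact mul_left_cancel₀ (left_ne_zero_of_mul_eq_one h) (h2.trans h.symm)

theorem conj_ell (x : F) : (starRingEnd ℂ) (ell x) = ell x := by
  simp [ell, -quadraticChar_apply]

/-- The quadratic exponential sum with leading coefficient `a` is a multiplicative shift of the
Gauss sum of the quadratic character. -/
theorem sum_addChar_mul_sq (hF : ringChar F ≠ 2) {ψ : AddChar F ℂ} (hψ : ψ ≠ 1) {a : F}
    (ha : a ≠ 0) : ∑ x, ψ (a * x ^ 2) = ell a * gaussSum (quadChar F) ψ := by
  have h1 : ∑ x, ψ (a * x ^ 2) = ∑ y, (ell y + 1) * ψ (a * y) := by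
    rw [← Finset.sum_fiberwise (s := Finset.univ) (g := fun x : F => x ^ 2)]
    refine Finset.sum_congr rfl fun y _ => ?_
    rw [Finset.sum_congr rfl (g := fun _ => ψ (a * y))
      (fun x hx => by rw [(Finset.mem_filter.1 hx).2])]
    rw [Finset.sum_const, nsmul_eq_mul]
    congr 1
    have := quadraticChar_card_sqrts hF y
    rw [Set.toFinset_ofPred] at this
    rw [ell]
    exact_mod_cast this
  have h2 : ∑ y, ψ (a * y) = 0 := by
    have := AddChar.sum_eq_zero_of_ne_one (AddChar.IsPrimitive.of_ne_one hψ ha)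
    simpa using this
  have h3 := gaussSum_mulShift (quadChar F) ψ (Units.mk0 a ha)
  rw [Units.val_mk0, quadChar_apply] at h3
  rw [h1, ← h3, ← mul_assoc, ell_mul_self ha, one_mul, gaussSum]
  simp_rw [add_mul, one_mul, Finset.sum_add_distrib, h2, add_zero, quadChar_apply,
    AddChar.mulShift_apply]

theorem quadChar_gaussSum_sq (hF : ringChar F ≠ 2) {ψ : AddChar F ℂ} (hψ : ψ ≠ 1) :
    gaussSum (quadChar F) ψ ^ 2 = ell (-1 : F) * Fintype.card F := by
  refine gaussSum_sq ?_ ?_ (AddChar.IsPrimitive.of_ne_one hψ)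
  · obtain ⟨a, ha⟩ := quadraticChar_exists_neg_one hF
    intro h
    have h1 := congrArg (fun χ => χ a) h
    have ha0 : a ≠ 0 := by rintro rfl; simp at ha
    simp only [quadChar_apply, ell, ha, MulChar.one_apply (Ne.isUnit ha0)] at h1
    norm_num at h1
  · exact (quadraticChar_isQuadratic F).comp _

end GaussSum

/-! ### The Gauss sum of the prime field -/

section PrimeField

variable {p : ℕ} [Fact p.Prime]

theorem tau_pow_eq_one : tau p ^ p = 1 := by
  rw [tau, ← pow_mul, mul_comm, pow_mul, omega_primitive.pow_eq_one, one_pow]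

theorem tau_sq (hp : p ≠ 2) : tau p ^ 2 = omega p := by
  have := (Fact.out : p.Prime).odd_of_ne_two hp
  obtain ⟨m, hm⟩ := this
  rw [tau, ← pow_mul, show (p + 1) / 2 * 2 = p + 1 by omega, pow_succ,
    omega_primitive.pow_eq_one, one_mul]

/-- The additive character `x ↦ τ ^ x` of the prime field. -/
noncomputable def tauChar (p : ℕ) [Fact p.Prime] : AddChar (ZMod p) ℂ :=
  AddChar.zmodChar p tau_pow_eq_one

/-- The additive character `x ↦ ω ^ x` of the prime field. -/
noncomputable def omegaChar (p : ℕ) [Fact p.Prime] : AddChar (ZMod p) ℂ :=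
  AddChar.zmodChar p omega_primitive.pow_eq_one

theorem mulShift_tauChar (hp : p ≠ 2) : (tauChar p).mulShift 2 = omegaChar p := by
  ext x
  rw [AddChar.mulShift_apply, two_mul, AddChar.map_add_eq_mul, ← sq, omegaChar, tauChar,
    AddChar.zmodChar_apply, AddChar.zmodChar_apply, ← tau_sq hp, ← pow_mul, ← pow_mul, mul_comm]

theorem omegaChar_ne_one : omegaChar p ≠ 1 := by
  have : Fact (1 < p) := ⟨(Fact.out : p.Prime).one_lt⟩
  rw [AddChar.zmod_char_ne_one_iff, omegaChar, AddChar.zmodChar_apply, ZMod.val_one, pow_one]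
  exact omega_primitive.ne_one (Fact.out : p.Prime).one_lt

theorem tauChar_ne_one (hp : p ≠ 2) : tauChar p ≠ 1 := by
  intro h
  apply omegaChar_ne_one (p := p)
  rw [← mulShift_tauChar hp, h]
  ext; simp

theorem ringChar_zmod_ne_two (hp : p ≠ 2) : ringChar (ZMod p) ≠ 2 := by
  rwa [ZMod.ringChar_zmod_n]

/-- Signs are determined by their residues modulo an odd prime. -/
theorem int_eq_of_cast_zmod_eq (hp : p ≠ 2) {a b : ℤ} (ha : a = 1 ∨ a = -1) (hb : b = 1 ∨ b = -1)
    (h : (a : ZMod p) = b) : a = b := by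
  have h1 : ringChar (ZMod p) ≠ 2 := ringChar_zmod_ne_two hp
  have h2 := Ring.neg_one_ne_one_of_char_ne_two h1
  rcases ha with rfl | rfl <;> rcases hb with rfl | rfl <;> push_cast at h
  exacts [rfl, absurd h.symm h2, absurd h h2, rfl]

/-- The quadratic Gauss sum of the prime field for the character `x ↦ τ ^ x`, with its sign. -/
theorem gaussSum_tauChar (hp : p ≠ 2) {m : ℕ} (hm : p = 2 * m + 1) :
    gaussSum (quadChar (ZMod p)) (tauChar p) = (-Complex.I) ^ m * (Real.sqrt p : ℝ) := by
  have hF := ringChar_zmod_ne_two hp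
  have h20 : (2 : ZMod p) ≠ 0 := Ring.two_ne_zero hF
  have hneg : ell (-1 : ZMod p) = (-1) ^ m := by
    have h1 := quadraticChar_cast_eq_pow hm (-1 : ZMod p)
    have := int_eq_of_cast_zmod_eq hp (quadraticChar_dichotomy (neg_ne_zero.2 one_ne_zero))
      (neg_one_pow_eq_or ℤ m) (by rw [h1]; simp)
    rw [ell, this]; simp
  have hω : gaussSum (quadChar (ZMod p)) (omegaChar p) =
      ∑ j ∈ Finset.range p, ((quadraticChar (ZMod p) (j : ZMod p) : ℤ) : ℂ) * omega p ^ j := by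
    rw [gaussSum, sum_zmod_eq_sum_range]
    refine Finset.sum_congr rfl fun j hj => ?_
    rw [omegaChar, AddChar.zmodChar_apply, ZMod.val_cast_of_lt (Finset.mem_range.1 hj)]; rfl
  have hsq : gaussSum (quadChar (ZMod p)) (omegaChar p) ^ 2 =
      (∏ k ∈ Finset.range m, (omega p ^ (k + 1) - omega p ^ (p - (k + 1)))) ^ 2 := by
    rw [prod_sub_inv_sq hm omega_primitive, quadChar_gaussSum_sq hF omegaChar_ne_one, hneg,
      ZMod.card]
  obtain ⟨ε, hε1, hε⟩ : ∃ ε : ℤ, (ε = 1 ∨ ε = -1) ∧ gaussSum (quadChar (ZMod p)) (omegaChar p) =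
      ε * ∏ k ∈ Finset.range m, (omega p ^ (k + 1) - omega p ^ (p - (k + 1))) := by
    rcases sq_eq_sq_iff_eq_or_eq_neg.1 hsq with h | h
    · exact ⟨1, Or.inl rfl, by simpa using h⟩
    · exact ⟨-1, Or.inr rfl, by simpa using h⟩
  -- The congruence gives `ε = χ(2) (-1) ^ m` for the quadratic character `χ`; the factor `χ(2)`
  -- cancels on passing from `ω` to `τ`, as `ω = τ ^ 2`.
  have hc := sign_congruence hm omega_primitive ε (hω ▸ hε)
  rw [factorial_half_sq hm, ← quadraticChar_cast_eq_pow hm] at hc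
  have hd := quadraticChar_dichotomy h20
  have hint : quadraticChar (ZMod p) 2 * ε = (-1) ^ m := by
    refine int_eq_of_cast_zmod_eq hp ?_ (neg_one_pow_eq_or ℤ m) ?_
    · rcases hd with h | h <;> rcases hε1 with h' | h' <;> rw [h, h'] <;> simp
    · have h5 : ((-1 : ZMod p) ^ m) ^ 2 = 1 := by rw [← pow_mul, mul_comm, pow_mul]; simp
      push_cast
      linear_combination (-(-1) ^ m) * hc -
        (quadraticChar (ZMod p) 2 : ZMod p) * (ε : ZMod p) * h5
  have h3 := gaussSum_mulShift (quadChar (ZMod p)) (tauChar p) (Units.mk0 2 h20)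
  rw [Units.val_mk0, mulShift_tauChar hp, hε, prod_omega hm, quadChar_apply, ell] at h3
  have h4 : ((quadraticChar (ZMod p) 2 : ℤ) : ℂ) * ε = (-1) ^ m := by exact_mod_cast hint
  rw [← h3, neg_pow, ← h4]; ring

end PrimeField

/-! ### Passage to the extension field -/

section Extension

variable {p : ℕ} [Fact p.Prime] {K : Type*} [Field K] [Algebra (ZMod p) K]

/-- The quadratic character of the discriminant of the trace form of `K` over its prime field, for
a basis `v` diagonalising the form: Frobenius permutes the rows of the matrix of conjugates
`v j ^ p ^ i` cyclically, so `det ^ (p - 1)` is the sign of a cycle of length `n`. -/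
theorem prod_ell_trace_basis [Fintype K] (hp : p ≠ 2) {n : ℕ} (v : Module.Basis (Fin n) (ZMod p) K)
    (hv : (Algebra.traceForm (ZMod p) K).IsOrthoᵢ v) (hn : 0 < n)
    (hv0 : ∀ i, Algebra.trace (ZMod p) K (v i * v i) ≠ 0) :
    ∏ i, ell (Algebra.trace (ZMod p) K (v i * v i)) = (-1) ^ (n - 1) := by
  obtain ⟨m, hm⟩ := (Fact.out : p.Prime).odd_of_ne_two hp
  have hfin : Module.finrank (ZMod p) K = n := by
    rw [Module.finrank_eq_card_basis v, Fintype.card_fin]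
  have hcard : Fintype.card K = p ^ n := by
    rw [Module.card_eq_pow_finrank (K := ZMod p), hfin, ZMod.card]
  have : CharP K p := charP_of_injective_algebraMap (algebraMap (ZMod p) K).injective p
  -- `Mᵀ M` is the Gram matrix of the trace form, which is diagonal in the basis `v`.
  let M : Matrix (Fin n) (Fin n) K := Matrix.of fun i j => v j ^ p ^ (i : ℕ)
  have hMM : M.transpose * M =
      Matrix.diagonal fun i => algebraMap (ZMod p) K (Algebra.trace (ZMod p) K (v i * v i)) := by
    ext j k
    have : (M.transpose * M) j k =
        algebraMap (ZMod p) K (Algebra.trace (ZMod p) K (v j * v k)) := by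
      rw [FiniteField.algebraMap_trace_eq_sum_pow, hfin, Finset.sum_range, Matrix.mul_apply]
      refine Finset.sum_congr rfl fun i _ => ?_
      simp [M, mul_pow]
    rw [this]
    by_cases hjk : j = k
    · subst hjk; simp
    · rw [Matrix.diagonal_apply_ne _ hjk]
      have : Algebra.trace (ZMod p) K (v j * v k) = 0 := hv hjk
      rw [this, map_zero]
  have hdet : M.det ^ 2 =
      algebraMap (ZMod p) K (∏ i, Algebra.trace (ZMod p) K (v i * v i)) := by
    have := congrArg Matrix.det hMM
    rw [Matrix.det_mul, Matrix.det_transpose, Matrix.det_diagonal] at this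
    rw [sq, this, map_prod]
  have hdet0 : M.det ≠ 0 := by
    intro h
    rw [h, zero_pow two_ne_zero, eq_comm, map_eq_zero] at hdet
    exact Finset.prod_ne_zero_iff.2 (fun i _ => hv0 i) hdet
  have hfrob : M.det ^ p = (-1) ^ (n - 1) * M.det := by
    obtain ⟨k, rfl⟩ : ∃ k, n = k + 1 := ⟨n - 1, by omega⟩
    have h1 : (frobenius K p).mapMatrix M = M.submatrix (finRotate (k + 1)) id := by
      ext i j
      simp only [RingHom.mapMatrix_apply, Matrix.map_apply, Matrix.submatrix_apply, id, M,
        Matrix.of_apply, frobenius_def, ← pow_mul, ← pow_succ]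
      rcases eq_or_ne i (Fin.last k) with rfl | hi
      · rw [finRotate_last, Fin.val_last, ← hcard, FiniteField.pow_card]; simp
      · rw [coe_finRotate_of_ne_last hi]
    have h2 := RingHom.map_det (frobenius K p) M
    rw [h1, Matrix.det_permute, sign_finRotate, frobenius_def] at h2
    rw [h2]; simp
  have hpow : M.det ^ (2 * m) = (-1) ^ (n - 1) := by
    rw [hm, pow_succ] at hfrob
    exact mul_right_cancel₀ hdet0 hfrob
  rw [pow_mul, hdet, ← map_pow, ← quadraticChar_cast_eq_pow hm] at hpow
  have hint : quadraticChar (ZMod p) (∏ i, Algebra.trace (ZMod p) K (v i * v i)) =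
      (-1) ^ (n - 1) := by
    refine int_eq_of_cast_zmod_eq hp (quadraticChar_dichotomy ?_) (neg_one_pow_eq_or ℤ _) ?_
    · exact Finset.prod_ne_zero_iff.2 (fun i _ => hv0 i)
    · apply (algebraMap (ZMod p) K).injective
      rw [hpow]; simp
  simp only [ell]
  rw [map_prod] at hint
  exact_mod_cast hint

theorem tauTr_eq (x : K) : tauTr p x = tauChar p (Algebra.trace (ZMod p) K x) := by
  rw [tauChar, AddChar.zmodChar_apply, tauTr]

/-- The additive character `x ↦ τ ^ tr x` of `K`. -/
noncomputable def tauTrChar (p : ℕ) [Fact p.Prime] (K : Type*) [Field K] [Algebra (ZMod p) K] :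
    AddChar K ℂ :=
  (tauChar p).compAddMonoidHom (Algebra.trace (ZMod p) K).toAddMonoidHom

theorem tauTrChar_apply (x : K) : tauTrChar p K x = tauTr p x := by
  rw [tauTr_eq]; rfl

theorem omegaTr_eq (hp : p ≠ 2) (x : K) : omegaTr p x = tauTrChar p K (2 * x) := by
  rw [two_mul, AddChar.map_add_eq_mul, tauTrChar_apply, tauTr, omegaTr, ← tau_sq hp, ← sq,
    ← pow_mul, ← pow_mul, mul_comm]

theorem tauTrChar_ne_one [Finite K] (hp : p ≠ 2) : tauTrChar p K ≠ 1 := by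
  have hs := Algebra.trace_surjective (ZMod p) K
  intro h
  apply tauChar_ne_one hp
  ext x
  obtain ⟨y, rfl⟩ := hs x
  rw [← tauTr_eq, ← tauTrChar_apply, h]; rfl

theorem ringChar_ne_two (hp : p ≠ 2) : ringChar K ≠ 2 := by
  have : CharP K p := charP_of_injective_algebraMap (algebraMap (ZMod p) K).injective p
  rwa [ringChar.eq K p]

/-- The quadratic exponential sum of `K`, with its sign: after diagonalising the trace form it is
a product of quadratic exponential sums over the prime field. -/
theorem sum_tauTr_sq [Fintype K] (hp : p ≠ 2) {m n : ℕ} (hm : p = 2 * m + 1)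
    (hK : Fintype.card K = p ^ n) :
    ∑ x : K, tauTr p (x ^ 2) =
      (-1) ^ (n - 1) * ((-Complex.I) ^ m) ^ n * (Real.sqrt ((p : ℝ) ^ n) : ℝ) := by
  have hfin : Module.finrank (ZMod p) K = n := by
    rw [Module.card_eq_pow_finrank (K := ZMod p), ZMod.card] at hK
    exact Nat.pow_right_injective (Fact.out : p.Prime).two_le hK
  have hn : 0 < n := hfin ▸ Module.finrank_pos
  have hF := ringChar_zmod_ne_two hp
  have : Invertible (2 : ZMod p) := invertibleOfNonzero (Ring.two_ne_zero hF)
  have hnd := traceForm_nondegenerate (ZMod p) K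
  obtain ⟨v, hv⟩ := LinearMap.BilinForm.exists_orthogonal_basis
    (B := Algebra.traceForm (ZMod p) K)
    (LinearMap.BilinForm.isSymm_iff.1 (Algebra.traceForm_isSymm (ZMod p)))
  have hv' : LinearMap.IsOrthoᵢ (Algebra.traceForm (ZMod p) K) v := hv
  have hv0 := hv'.not_isOrtho_basis_self_of_separatingLeft hnd.1
  clear hv
  revert v
  rw [hfin]
  intro v hv hv0
  replace hv0 : ∀ i, Algebra.trace (ZMod p) K (v i * v i) ≠ 0 := fun i => hv0 i
  have h1 : ∀ c : Fin n → ZMod p, tauTr p ((v.equivFun.symm c) ^ 2) =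
      ∏ i, tauChar p (Algebra.trace (ZMod p) K (v i * v i) * (c i) ^ 2) := by
    intro c
    rw [tauTr_eq, ← addChar_map_sum]
    congr 1
    rw [v.equivFun_symm_apply, sq, Finset.sum_mul_sum, map_sum]
    refine Finset.sum_congr rfl fun i _ => ?_
    rw [map_sum, Finset.sum_eq_single i]
    · rw [smul_mul_smul_comm, map_smul, smul_eq_mul]; ring
    · intro j _ hj
      have : Algebra.trace (ZMod p) K (v i * v j) = 0 := hv hj.symm
      rw [smul_mul_smul_comm, map_smul, this, smul_zero]
    · simp
  rw [← v.equivFun.symm.toEquiv.sum_comp]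
  simp only [LinearEquiv.coe_toEquiv, h1]
  have h2 := Finset.prod_univ_sum (fun _ : Fin n => (Finset.univ : Finset (ZMod p)))
    (fun i t => tauChar p (Algebra.trace (ZMod p) K (v i * v i) * t ^ 2))
  rw [Fintype.piFinset_univ] at h2
  rw [← h2]
  simp_rw [sum_addChar_mul_sq hF (tauChar_ne_one hp) (hv0 _), Finset.prod_mul_distrib,
    prod_ell_trace_basis hp v hv hn hv0, gaussSum_tauChar hp hm]
  rw [Finset.prod_const, Finset.card_univ, Fintype.card_fin, mul_pow, mul_assoc]
  congr 3
  rw [Real.sqrt_eq_rpow, Real.sqrt_eq_rpow, ← Complex.ofReal_pow, ← Real.rpow_natCast,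
    ← Real.rpow_natCast, ← Real.rpow_mul (by positivity), ← Real.rpow_mul (by positivity),
    mul_comm]

end Extension

/-! ### The matrices of the Weil representation -/

/-- The phase in `ellTilde`. By `sum_tauTr_sq_eq_phase` it is the normalised quadratic Gauss sum of
a field with `p ^ n` elements. -/
noncomputable def phase (p n : ℕ) : ℂ := -(Complex.I ^ (-((n * (p + 3) / 2 : ℕ) : ℤ)))

theorem ellTilde_of_ne_zero {p n : ℕ} {K : Type*} [Field K] [Fintype K] [DecidableEq K]
    {x : K} (hx : x ≠ 0) : ellTilde p n x = phase p n * ell x := by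
  rw [ellTilde, if_neg hx, phase]

theorem sqrt_card_sq {p n : ℕ} :
    ((Real.sqrt ((p : ℝ) ^ n) : ℝ) : ℂ) * (Real.sqrt ((p : ℝ) ^ n) : ℝ) =
    (p : ℂ) ^ n := by
  rw [← Complex.ofReal_mul, Real.mul_self_sqrt (by positivity)]; push_cast; rfl

section Entries

variable {p n : ℕ} {K : Type*} [Field K] [Fintype K] [DecidableEq K] [Algebra (ZMod p) K]

theorem matU_of_eq_zero {F : Matrix (Fin 2) (Fin 2) K} (h : F 0 1 = 0) (x y : K) :
    matU p n F x y =
      if x = F 0 0 * y then ell (F 0 0) * tauTr p (F 0 0 * F 1 0 * y ^ 2) else 0 := by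
  rw [matU, if_pos h]; rfl

theorem matU_of_ne_zero {F : Matrix (Fin 2) (Fin 2) K} (h : F 0 1 ≠ 0) (x y : K) :
    matU p n F x y = phase p n * ell (-(F 0 1)) / (Real.sqrt ((p : ℝ) ^ n) : ℂ) *
        tauTr p ((F 0 1)⁻¹ * (F 0 0 * y ^ 2 - 2 * x * y + F 1 1 * x ^ 2)) := by
  rw [matU, if_neg h, ellTilde_of_ne_zero (neg_ne_zero.2 h)]; rfl

end Entries

section Weil

variable {p n : ℕ} [Fact p.Prime] {K : Type*} [Field K] [Algebra (ZMod p) K]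

theorem tauTr_add (x y : K) : tauTr p (x + y) = tauTr p x * tauTr p y := by
  rw [← tauTrChar_apply, AddChar.map_add_eq_mul, tauTrChar_apply, tauTrChar_apply]

theorem tauTr_zero : tauTr p (0 : K) = 1 := by
  rw [← tauTrChar_apply, AddChar.map_zero_eq_one]

theorem conj_tauTr (x : K) : (starRingEnd ℂ) (tauTr p x) = tauTr p (-x) := by
  have h : ‖tauTr p x‖ = 1 := by
    rw [tauTr, norm_pow]
    rw [Complex.norm_eq_one_of_pow_eq_one tau_pow_eq_one (Fact.out : p.Prime).ne_zero, one_pow]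
  have h1 : tauTr p x * tauTr p (-x) = 1 := by rw [← tauTr_add, add_neg_cancel, tauTr_zero]
  have h2 : tauTr p x * (starRingEnd ℂ) (tauTr p x) = 1 := by
    rw [Complex.mul_conj, Complex.normSq_eq_norm_sq, h]; simp
  exact mul_left_cancel₀ (left_ne_zero_of_mul_eq_one h1) (h2.trans h1.symm)

theorem sum_tauTr_sq_eq_phase [Fintype K] (hp : p ≠ 2) (hK : Fintype.card K = p ^ n) :
    ∑ x : K, tauTr p (x ^ 2) = phase p n * (Real.sqrt ((p : ℝ) ^ n) : ℝ) := by
  obtain ⟨m, hm⟩ := (Fact.out : p.Prime).odd_of_ne_two hp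
  have hn : 0 < n := by
    rcases n with _ | n
    · have := Fintype.one_lt_card (α := K); rw [hK] at this; simp at this
    · omega
  rw [sum_tauTr_sq hp hm hK]
  congr 1
  have h1 : n * (p + 3) / 2 = m * n + 2 * n := by
    rw [hm, show n * (2 * m + 1 + 3) = 2 * (m * n + 2 * n) by ring]; simp
  obtain ⟨k, rfl⟩ : ∃ k, n = k + 1 := ⟨n - 1, by omega⟩
  rw [phase, h1, zpow_neg, zpow_natCast, ← inv_pow, Complex.inv_I,
    pow_add _ (m * (k + 1)), pow_mul (-Complex.I) m, pow_mul (-Complex.I) 2, neg_sq,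
    Complex.I_sq, pow_succ (-1 : ℂ), Nat.add_sub_cancel]
  ring

theorem sqrt_card_ne_zero : ((Real.sqrt ((p : ℝ) ^ n) : ℝ) : ℂ) ≠ 0 := by
  have := (Fact.out : p.Prime).pos
  rw [Complex.ofReal_ne_zero]; positivity

variable [Fintype K] [DecidableEq K]

theorem gaussSum_tauTrChar (hp : p ≠ 2) (hK : Fintype.card K = p ^ n) :
    gaussSum (quadChar K) (tauTrChar p K) = phase p n * (Real.sqrt ((p : ℝ) ^ n) : ℝ) := by
  rw [← sum_tauTr_sq_eq_phase hp hK]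
  have h := sum_addChar_mul_sq (ringChar_ne_two (K := K) hp) (tauTrChar_ne_one hp) one_ne_zero
  simp only [one_mul, tauTrChar_apply] at h
  rw [h]; simp [ell]

theorem phase_mul_self (hp : p ≠ 2) (hK : Fintype.card K = p ^ n) :
    phase p n * phase p n = ell (-1 : K) := by
  have h := quadChar_gaussSum_sq (ringChar_ne_two (K := K) hp) (tauTrChar_ne_one hp)
  rw [gaussSum_tauTrChar hp hK, hK, Nat.cast_pow, ← sqrt_card_sq] at h
  have h0 := sqrt_card_ne_zero (p := p) (n := n)
  exact mul_right_cancel₀ (mul_ne_zero h0 h0) (by linear_combination h)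

theorem conj_phase (hp : p ≠ 2) (hK : Fintype.card K = p ^ n) :
    (starRingEnd ℂ) (phase p n) = ell (-1 : K) * phase p n := by
  have h1 : ‖phase p n‖ = 1 := by rw [phase, norm_neg, norm_zpow, Complex.norm_I, one_zpow]
  have h2 : phase p n * (starRingEnd ℂ) (phase p n) = 1 := by
    rw [Complex.mul_conj, Complex.normSq_eq_norm_sq, h1]; simp
  have h3 : phase p n * (ell (-1 : K) * phase p n) = 1 := by
    rw [mul_left_comm, phase_mul_self hp hK, ell_mul_self (neg_ne_zero.2 one_ne_zero)]
  exact mul_left_cancel₀ (left_ne_zero_of_mul_eq_one h2) (h2.trans h3.symm)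

/-- Completing the square in a non-degenerate quadratic exponential sum. -/
theorem sum_tauTr_quadratic (hp : p ≠ 2) (hK : Fintype.card K = p ^ n) {a : K} (ha : a ≠ 0)
    (b c : K) : ∑ z, tauTr p (a * z ^ 2 - 2 * b * z + c) =
      ell a * (phase p n * (Real.sqrt ((p : ℝ) ^ n) : ℝ)) * tauTr p (c - b ^ 2 / a) := by
  rw [← gaussSum_tauTrChar hp hK,
    ← sum_addChar_mul_sq (ringChar_ne_two (K := K) hp) (tauTrChar_ne_one hp) ha, Finset.sum_mul,
    ← Equiv.sum_comp (Equiv.addRight (b / a))]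
  refine Finset.sum_congr rfl fun z _ => ?_
  rw [tauTrChar_apply, ← tauTr_add]
  congr 1
  simp only [Equiv.coe_addRight]
  field_simp
  ring

theorem sum_tauTr_linear (hp : p ≠ 2) (hK : Fintype.card K = p ^ n) (b : K) :
    ∑ z, tauTr p (b * z) = if b = 0 then (p : ℂ) ^ n else 0 := by
  have h := AddChar.sum_mulShift b (AddChar.IsPrimitive.of_ne_one (tauTrChar_ne_one (K := K) hp))
  simp_rw [tauTrChar_apply, hK, mul_comm _ b] at h
  rw [h]; push_cast; rfl

theorem matU_one : matU p n (1 : Matrix (Fin 2) (Fin 2) K) = 1 := by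
  ext x y
  rw [matU_of_eq_zero (by simp)]
  simp [ell, tauTr_zero, Matrix.one_apply]

/-- Multiplicativity of `F ↦ matU F` when the left factor is lower triangular. -/
theorem matU_mul_of_left_eq_zero {a c d a' b' c' d' : K} (hF : a * d = 1) :
    matU p n !![a, 0; c, d] * matU p n !![a', b'; c', d'] =
      matU p n (!![a, 0; c, d] * !![a', b'; c', d']) := by
  rw [Matrix.mul_fin_two]
  ext x y
  rw [Matrix.mul_apply]
  simp only [zero_mul, add_zero]
  have ha : a ≠ 0 := left_ne_zero_of_mul_eq_one hF
  have hd : d = a⁻¹ := eq_inv_of_mul_eq_one_right hF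
  subst hd
  simp_rw [matU_of_eq_zero (F := !![a, 0; c, a⁻¹]) (by simp)]
  rw [Finset.sum_eq_single (a⁻¹ * x)]
  rotate_left
  · intro z _ hz
    rw [if_neg, zero_mul]
    rintro hx
    apply hz
    rw [hx]; simp [ha]
  · simp
  rw [if_pos (by simp [ha])]
  by_cases hb' : b' = 0
  · subst hb'
    rw [matU_of_eq_zero (by simp), matU_of_eq_zero (by simp)]
    have hx : a⁻¹ * x = a' * y ↔ x = a * a' * y := by
      rw [inv_mul_eq_iff_eq_mul₀ ha, mul_assoc]
    simp [hx]
    split_ifs with h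
    · rw [ell_mul, mul_mul_mul_comm, ← tauTr_add]
      congr 2
      rw [h]
      field_simp
    · rfl
  · rw [matU_of_ne_zero (by simpa using hb'), matU_of_ne_zero (by simp [hb', ha])]
    simp
    rw [show -(a * b') = a * -b' by ring, ell_mul]
    have : ∀ s t : K, ∀ A B C D : ℂ, A * tauTr p s * (B * C / D * tauTr p t) =
      B * (A * C) / D * tauTr p (s + t) := by
      intro s t A B C D; rw [tauTr_add]; ring
    rw [this]
    congr 2
    field_simp
    ring

/-- Multiplicativity of `F ↦ matU F` when only the right factor is lower triangular. -/
theorem matU_mul_of_right_eq_zero {a b c d a' c' d' : K} (hb : b ≠ 0) (hG : a' * d' = 1) :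
    matU p n !![a, b; c, d] * matU p n !![a', 0; c', d'] =
      matU p n (!![a, b; c, d] * !![a', 0; c', d']) := by
  rw [Matrix.mul_fin_two]
  ext x y
  rw [Matrix.mul_apply]
  simp_rw [matU_of_ne_zero (F := !![a, b; c, d]) (by simpa using hb)]
  have ha' : a' ≠ 0 := left_ne_zero_of_mul_eq_one hG
  have hd : d' = a'⁻¹ := eq_inv_of_mul_eq_one_right hG
  subst hd
  simp_rw [matU_of_eq_zero (F := !![a', 0; c', a'⁻¹]) (by simp)]
  rw [Finset.sum_eq_single (a' * y)]
  rotate_left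
  · intro z _ hz
    rw [if_neg (by simpa using hz), mul_zero]
  · simp
  rw [if_pos (by simp), matU_of_ne_zero (by simp [hb, ha'])]
  simp
  rw [← neg_mul, ell_mul, ell_inv]
  have : ∀ s t : K, ∀ A B C D : ℂ, B * C / D * tauTr p t * (A * tauTr p s) =
    B * (C * A) / D * tauTr p (t + s) := by
    intro s t A B C D; rw [tauTr_add]; ring
  rw [this]
  congr 2
  field_simp
  ring

/-- Multiplicativity of `F ↦ matU F` when neither factor is lower triangular: the sum over the
intermediate index is a quadratic exponential sum, degenerating to a delta function when the product
is lower triangular. -/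
theorem matU_mul_of_ne_zero (hp : p ≠ 2) (hK : Fintype.card K = p ^ n) {a b c d a' b' c' d' : K}
    (hb : b ≠ 0) (hb' : b' ≠ 0) (hF : a * d - b * c = 1) (hG : a' * d' - b' * c' = 1) :
    matU p n !![a, b; c, d] * matU p n !![a', b'; c', d'] =
      matU p n (!![a, b; c, d] * !![a', b'; c', d']) := by
  have hd0 := sqrt_card_ne_zero (p := p) (n := n)
  have hdd := sqrt_card_sq (p := p) (n := n)
  have hcc := phase_mul_self hp hK
  have h2 : (2 : K) ≠ 0 := Ring.two_ne_zero (ringChar_ne_two (K := K) hp)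
  rw [Matrix.mul_fin_two]
  ext x y
  rw [Matrix.mul_apply]
  simp_rw [matU_of_ne_zero (F := !![a, b; c, d]) (by simpa using hb)]
  simp_rw [matU_of_ne_zero (F := !![a', b'; c', d']) (by simpa using hb')]
  simp
  have hS : ∀ z, phase p n * ell (-b) / (Real.sqrt ((p : ℝ) ^ n) : ℂ) *
      tauTr p (b⁻¹ * (a * z ^ 2 - 2 * x * z + d * x ^ 2)) *
      (phase p n * ell (-b') / (Real.sqrt ((p : ℝ) ^ n) : ℂ) *
      tauTr p (b'⁻¹ * (a' * y ^ 2 - 2 * z * y + d' * z ^ 2))) =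
      phase p n * phase p n * ell (b * b') / (p : ℂ) ^ n *
      tauTr p ((a * b' + b * d') / (b * b') * z ^ 2 - 2 * (x / b + y / b') * z +
        (d * x ^ 2 / b + a' * y ^ 2 / b')) := by
    intro z
    have : (a * b' + b * d') / (b * b') * z ^ 2 - 2 * (x / b + y / b') * z +
        (d * x ^ 2 / b + a' * y ^ 2 / b') = b⁻¹ * (a * z ^ 2 - 2 * x * z + d * x ^ 2) +
          b'⁻¹ * (a' * y ^ 2 - 2 * z * y + d' * z ^ 2) := by
      field_simp; ring
    rw [this, tauTr_add, ← hdd, ← neg_mul_neg b b', ell_mul]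
    field_simp
  simp_rw [hS]
  rw [← Finset.mul_sum]
  -- `a * b' + b * d'` is the upper right entry of the product and, up to a unit, the coefficient of
  -- `z ^ 2`.
  by_cases hb2 : a * b' + b * d' = 0
  · rw [matU_of_eq_zero (by simpa using hb2)]
    simp only [hb2, zero_div, zero_mul, zero_sub, tauTr_add, ← Finset.sum_mul, ← neg_mul]
    rw [sum_tauTr_linear hp hK]
    -- The product is lower triangular with upper left entry `-(b / b')`, and the linear exponential
    -- sum is supported on `x = -(b / b') * y`.
    have ha2 : a * a' + b * c' = -(b / b') := by
      field_simp
      linear_combination a' * hb2 - b * hG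
    have hx : -2 * (x / b + y / b') = 0 ↔ x = (a * a' + b * c') * y := by
      rw [ha2]
      constructor
      · intro h
        have h' : x / b + y / b' = 0 := by
          rcases mul_eq_zero.1 h with h | h
          · exact absurd (neg_eq_zero.1 h) h2
          · exact h
        field_simp at h' ⊢
        linear_combination h'
      · rintro rfl
        field_simp
        ring
    simp only [hx, Matrix.of_apply, Matrix.cons_val', Matrix.cons_val_zero,
      Matrix.cons_val_one, Matrix.cons_val_fin_one]
    split_ifs with h
    · have hpn : (p : ℂ) ^ n ≠ 0 := by rw [← hdd]; exact mul_ne_zero hd0 hd0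
      rw [hcc, ← ell_mul, h, ← tauTr_add]
      have h5 : ell (-1 * (b * b')) = ell (a * a' + b * c') := by
        rw [ha2, ← neg_one_mul (b / b'), div_eq_mul_inv, ell_mul, ell_mul, ell_mul, ell_mul b,
          ell_inv]
      rw [h5]
      have h6 : d * ((a * a' + b * c') * y) ^ 2 / b + a' * y ^ 2 / b' =
          (a * a' + b * c') * (c * a' + d * c') * y ^ 2 := by
        have h7 : c * a' + d * c' = -(d / b' + a' / b) := by
          field_simp
          linear_combination (-(b' * a')) * hF - b * d * hG + a' * d * hb2
        rw [h7, ha2]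
        field_simp
      rw [h6]
      field_simp
    · simp
  · rw [matU_of_ne_zero (by simpa using hb2), sum_tauTr_quadratic hp hK
      (div_ne_zero hb2 (mul_ne_zero hb hb'))]
    simp only [Matrix.of_apply, Matrix.cons_val', Matrix.cons_val_zero,
      Matrix.cons_val_one, Matrix.cons_val_fin_one]
    -- Constant term left after completing the square.
    have h8 : d * x ^ 2 / b + a' * y ^ 2 / b' -
        (x / b + y / b') ^ 2 / ((a * b' + b * d') / (b * b')) =
        (a * b' + b * d')⁻¹ * ((a * a' + b * c') * y ^ 2 - 2 * x * y +
          (c * b' + d * d') * x ^ 2) := by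
      generalize hs : a * b' + b * d' = s at *
      field_simp
      linear_combination (b' ^ 2 * x ^ 2) * hF + (b ^ 2 * y ^ 2) * hG -
        (d * b' * x ^ 2 + a' * b * y ^ 2) * hs
    rw [h8, hcc, ← neg_one_mul (a * b' + b * d'), ell_mul (-1), div_eq_mul_inv _ (b * b'),
      ell_mul _ (b * b')⁻¹, ell_inv, ← hdd]
    have h9 := ell_mul_self (mul_ne_zero hb hb')
    rw [← hcc]
    generalize tauTr p (_ : K) = t
    generalize ell (a * b' + b * d') = e
    field_simp
    linear_combination (phase p n ^ 3 * e * t) * h9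

theorem matU_mul (hp : p ≠ 2) (hK : Fintype.card K = p ^ n) {F G : Matrix (Fin 2) (Fin 2) K}
    (hF : F.det = 1) (hG : G.det = 1) : matU p n F * matU p n G = matU p n (F * G) := by
  obtain ⟨a, b, c, d, rfl⟩ : ∃ a b c d, F = !![a, b; c, d] := ⟨_, _, _, _, Matrix.eta_fin_two F⟩
  obtain ⟨a', b', c', d', rfl⟩ : ∃ a b c d, G = !![a, b; c, d] :=
    ⟨_, _, _, _, Matrix.eta_fin_two G⟩
  rw [Matrix.det_fin_two_of] at hF hG
  rcases eq_or_ne b 0 with rfl | hb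
  · exact matU_mul_of_left_eq_zero (by simpa using hF)
  rcases eq_or_ne b' 0 with rfl | hb'
  · exact matU_mul_of_right_eq_zero hb (by simpa using hG)
  · exact matU_mul_of_ne_zero hp hK hb hb' hF hG

/-- The adjugate is the inverse for determinant `1`, so this is `U_F† = U_{F⁻¹}`. -/
theorem conjTranspose_matU (hp : p ≠ 2) (hK : Fintype.card K = p ^ n)
    {F : Matrix (Fin 2) (Fin 2) K} (hF : F.det = 1) :
    (matU p n F).conjTranspose = matU p n F.adjugate := by
  obtain ⟨a, b, c, d, rfl⟩ : ∃ a b c d, F = !![a, b; c, d] := ⟨_, _, _, _, Matrix.eta_fin_two F⟩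
  rw [Matrix.det_fin_two_of] at hF
  rw [Matrix.adjugate_fin_two_of]
  ext x y
  rw [Matrix.conjTranspose_apply, ← starRingEnd_apply]
  by_cases hb : b = 0
  · subst hb
    rw [zero_mul, sub_zero] at hF
    have ha : a ≠ 0 := left_ne_zero_of_mul_eq_one hF
    have hd : d = a⁻¹ := eq_inv_of_mul_eq_one_right hF
    subst hd
    rw [matU_of_eq_zero (by simp), matU_of_eq_zero (by simp)]
    have hx : y = a * x ↔ x = a⁻¹ * y := by rw [eq_inv_mul_iff_mul_eq₀ ha, eq_comm]
    simp [hx, ell_inv]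
    split_ifs with h
    · rw [map_mul, conj_ell, conj_tauTr, h]
      congr 2
      field_simp
    · simp
  · rw [matU_of_ne_zero (by simpa using hb), matU_of_ne_zero (by simpa using hb)]
    simp only [map_mul, map_div₀, conj_tauTr, conj_phase hp hK, conj_ell, Complex.conj_ofReal,
      Matrix.of_apply, Matrix.cons_val', Matrix.cons_val_zero, Matrix.cons_val_one,
      Matrix.cons_val_fin_one, neg_neg]
    rw [← neg_one_mul b, ell_mul]
    have h := ell_mul_self (neg_ne_zero.2 (one_ne_zero (α := K)))
    congr 1
    · linear_combination (phase p n * ell b / (Real.sqrt ((p : ℝ) ^ n) : ℂ)) * h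
    · congr 1; field_simp; ring

/-- Complex conjugation of the entries corresponds to conjugation by `J`. -/
theorem map_conj_matU (hp : p ≠ 2) (hK : Fintype.card K = p ^ n)
    (F : Matrix (Fin 2) (Fin 2) K) :
    (matU p n F).map (starRingEnd ℂ) = matU p n (J K * F * J K) := by
  obtain ⟨a, b, c, d, rfl⟩ : ∃ a b c d, F = !![a, b; c, d] := ⟨_, _, _, _, Matrix.eta_fin_two F⟩
  rw [show J K * !![a, b; c, d] * J K = !![a, -b; -c, d] by simp [J]]
  ext x y
  rw [Matrix.map_apply]
  by_cases hb : b = 0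
  · subst hb
    rw [matU_of_eq_zero (by simp), matU_of_eq_zero (by simp)]
    simp [apply_ite (starRingEnd ℂ), conj_ell, conj_tauTr]
  · rw [matU_of_ne_zero (by simpa using hb), matU_of_ne_zero (by simpa using hb)]
    simp only [map_mul, map_div₀, conj_tauTr, conj_phase hp hK, conj_ell, Complex.conj_ofReal,
      Matrix.of_apply, Matrix.cons_val', Matrix.cons_val_zero, Matrix.cons_val_one,
      Matrix.cons_val_fin_one, neg_neg]
    rw [← neg_one_mul b, ell_mul]
    have h := ell_mul_self (neg_ne_zero.2 (one_ne_zero (α := K)))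
    congr 1
    · linear_combination (phase p n * ell b / (Real.sqrt ((p : ℝ) ^ n) : ℂ)) * h
    · congr 1; field_simp

/-- The matrix of the displacement operator `D_u`. -/
noncomputable def matD (p : ℕ) {K : Type*} [Field K] [Fintype K] [DecidableEq K]
    [Algebra (ZMod p) K] (u : Fin 2 → K) : Matrix K K ℂ :=
  tauTr p (u 0 * u 1) • (matX (u 0) * matZ p (u 1))

theorem matD_apply (hp : p ≠ 2) (u : Fin 2 → K) (x y : K) :
    matD p u x y = if x = y + u 0 then tauTr p (u 0 * u 1 + 2 * (y * u 1)) else 0 := by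
  rw [matD, matZ, Matrix.smul_apply, Matrix.mul_diagonal, matX, Matrix.of_apply, tauTr_add,
    omegaTr_eq hp, tauTrChar_apply]
  split_ifs <;> simp

theorem map_conj_matD (hp : p ≠ 2) (u : Fin 2 → K) :
    (matD p u).map (starRingEnd ℂ) = matD p ((J K).mulVec u) := by
  ext x y
  rw [Matrix.map_apply, matD_apply hp, matD_apply hp, apply_ite (starRingEnd ℂ), conj_tauTr]
  simp [J, Matrix.mulVec, dotProduct, Fin.sum_univ_two]
  congr 2; ring

/-- Covariance of the displacement operators for determinant `1`. -/
theorem matU_mul_matD (hp : p ≠ 2) {F : Matrix (Fin 2) (Fin 2) K} (hF : F.det = 1)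
    (u : Fin 2 → K) : matU p n F * matD p u = matD p (F.mulVec u) * matU p n F := by
  obtain ⟨a, b, c, d, rfl⟩ : ∃ a b c d, F = !![a, b; c, d] := ⟨_, _, _, _, Matrix.eta_fin_two F⟩
  rw [Matrix.det_fin_two_of] at hF
  ext x y
  have h0 : (!![a, b; c, d].mulVec u) 0 = a * u 0 + b * u 1 := by
    simp [Matrix.mulVec, dotProduct, Fin.sum_univ_two]
  have h1 : (!![a, b; c, d].mulVec u) 1 = c * u 0 + d * u 1 := by
    simp [Matrix.mulVec, dotProduct, Fin.sum_univ_two]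
  rw [Matrix.mul_apply, Matrix.mul_apply, Finset.sum_eq_single (y + u 0),
    Finset.sum_eq_single (x - (a * u 0 + b * u 1))]
  rotate_left
  · intro z _ hz
    rw [matD_apply hp, if_neg, zero_mul]
    rw [h0]; rintro rfl; simp at hz
  · simp
  · intro z _ hz
    rw [matD_apply hp, if_neg hz, mul_zero]
  · simp
  rw [matD_apply hp, matD_apply hp, h0, h1, if_pos rfl, if_pos (by ring)]
  by_cases hb : b = 0
  · subst hb
    rw [zero_mul, sub_zero] at hF
    rw [matU_of_eq_zero (by simp), matU_of_eq_zero (by simp)]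
    have hx : x - (a * u 0 + 0 * u 1) = a * y ↔ x = a * (y + u 0) := by
      constructor
      · intro h; linear_combination h
      · intro h; linear_combination h
    simp only [hx, Matrix.of_apply, Matrix.cons_val', Matrix.cons_val_zero,
          Matrix.cons_val_one, Matrix.cons_val_fin_one]
    split_ifs with h
    · rw [mul_assoc, mul_left_comm (tauTr p _), ← tauTr_add, ← tauTr_add]
      congr 2
      rw [h]
      linear_combination (-(u 0 * u 1) - 2 * y * u 1) * hF
    · simp
  · rw [matU_of_ne_zero (by simpa using hb), matU_of_ne_zero (by simpa using hb)]
    simp only [Matrix.of_apply, Matrix.cons_val', Matrix.cons_val_zero,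
          Matrix.cons_val_one, Matrix.cons_val_fin_one]
    rw [mul_assoc, mul_left_comm (tauTr p _), ← tauTr_add, ← tauTr_add]
    congr 2
    field_simp
    linear_combination (2 * u 0 * x - b * u 0 * u 1 - a * u 0 ^ 2) * hF

end Weil

/-! ### Operators on the Hilbert space -/

section Operators

variable {K : Type*} [Fintype K]

theorem UJ_apply (ψ : Hilb K) (x : K) : UJ K ψ x = (starRingEnd ℂ) (ψ x) := rfl

theorem UJ_mul_UJ : UJ K * UJ K = 1 := by
  ext ψ x
  simp [UJ_apply]

theorem UJ_smul (c : ℂ) (ψ : Hilb K) : UJ K (c • ψ) = (starRingEnd ℂ) c • UJ K ψ := by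
  ext x
  simp [UJ_apply]

theorem dagger_mul (A B : Op K) : dagger (A * B) = dagger B * dagger A :=
  LinearMap.adjoint_comp A B

theorem dagger_UJ : dagger (UJ K) = UJ K := by
  symm
  rw [dagger, LinearMap.eq_adjoint_iff]
  intro ψ φ
  rw [real_inner_eq_re, real_inner_eq_re, PiLp.inner_apply, PiLp.inner_apply, Complex.re_sum,
    Complex.re_sum]
  simp [UJ_apply]

theorem isUnitaryOp_of_dagger_mul {A B : Op K} (hA : ∀ (c : ℂ) (ψ : Hilb K), A (c • ψ) = c • A ψ)
    (h : dagger A * A = 1) (hB : A * B = 1) : IsUnitaryOp A := by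
  refine ⟨hA, fun ψ => ⟨B ψ, LinearMap.congr_fun hB ψ⟩, fun ψ φ => ?_⟩
  rw [← inner_dagger_of_linear A hA, ← Module.End.mul_apply, h, Module.End.one_apply]

theorem isAntiUnitaryOp_of_dagger_mul {A B : Op K}
    (hA : ∀ (c : ℂ) (ψ : Hilb K), A (c • ψ) = (starRingEnd ℂ) c • A ψ)
    (h : dagger A * A = 1) (hB : A * B = 1) : IsAntiUnitaryOp A := by
  refine ⟨hA, fun ψ => ⟨B ψ, LinearMap.congr_fun hB ψ⟩, fun ψ φ => ?_⟩
  have h1 := inner_dagger_of_conjLinear A hA (A ψ) φ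
  rw [← Module.End.mul_apply, h, Module.End.one_apply] at h1
  rw [h1, Complex.conj_conj]

variable [DecidableEq K]

theorem ofMatrix_apply (M : Matrix K K ℂ) (ψ : Hilb K) (x : K) :
    ofMatrix M ψ x = ∑ y, M x y * ψ y := rfl

theorem ofMatrix_smul (M : Matrix K K ℂ) (c : ℂ) (ψ : Hilb K) :
    ofMatrix M (c • ψ) = c • ofMatrix M ψ :=
  map_smul (Matrix.toEuclideanLin M) c ψ

theorem ofMatrix_one : ofMatrix (1 : Matrix K K ℂ) = 1 := by
  ext ψ x
  simp [ofMatrix_apply, Matrix.one_apply]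

theorem ofMatrix_mul (M N : Matrix K K ℂ) : ofMatrix (M * N) = ofMatrix M * ofMatrix N := by
  ext ψ x
  simp only [ofMatrix_apply, Module.End.mul_apply, Matrix.mul_apply, Finset.sum_mul,
    Finset.mul_sum]
  rw [Finset.sum_comm]
  simp only [mul_assoc]

theorem UJ_mul_ofMatrix (M : Matrix K K ℂ) :
    UJ K * ofMatrix M = ofMatrix (M.map (starRingEnd ℂ)) * UJ K := by
  ext ψ x
  simp [ofMatrix_apply, UJ_apply]

theorem dagger_ofMatrix (M : Matrix K K ℂ) : dagger (ofMatrix M) = ofMatrix M.conjTranspose := by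
  symm
  rw [dagger, LinearMap.eq_adjoint_iff]
  intro ψ φ
  rw [real_inner_eq_re, real_inner_eq_re]
  congr 1
  have h := Matrix.toEuclideanLin_conjTranspose_eq_adjoint M
  change inner ℂ (Matrix.toEuclideanLin M.conjTranspose ψ) φ =
    inner ℂ ψ (Matrix.toEuclideanLin M φ)
  rw [h, LinearMap.adjoint_inner_left]

end Operators

/-! ### The representation of the extended symplectic group -/

section Group

variable {p n : ℕ} {K : Type*} [Field K]

/-- The matrix underlying an element of `ESL K`. -/
abbrev toMat (F : ESL K) : Matrix (Fin 2) (Fin 2) K :=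
  ((F : Matrix.GeneralLinearGroup (Fin 2) K) : Matrix (Fin 2) (Fin 2) K)

theorem det_toMat (F : ESL K) : (toMat F).det = 1 ∨ (toMat F).det = -1 := F.2

theorem det_J : (J K).det = -1 := by simp [J]

theorem det_mul_J {F : Matrix (Fin 2) (Fin 2) K} (hF : F.det = -1) : (F * J K).det = 1 := by
  rw [Matrix.det_mul, hF, det_J, neg_mul_neg, one_mul]

theorem J_mul_J : J K * J K = 1 := by
  ext i j; fin_cases i <;> fin_cases j <;> simp [J]

variable [Fintype K] [DecidableEq K] [Algebra (ZMod p) K]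

theorem D_eq (u : Fin 2 → K) : D p u = ofMatrix (matD p u) := rfl

theorem U_of_det_eq_one {F : ESL K} (h : (toMat F).det = 1) :
    U p n F = ofMatrix (matU p n (toMat F)) :=
  if_pos h

variable [Fact p.Prime]

theorem U_of_det_eq_neg_one (hp : p ≠ 2) {F : ESL K} (h : (toMat F).det = -1) :
    U p n F = ofMatrix (matU p n (toMat F * J K)) * UJ K :=
  if_neg fun h1 => Ring.neg_one_ne_one_of_char_ne_two (ringChar_ne_two (K := K) hp)
    (h.symm.trans h1)

theorem U_one : U p n (1 : ESL K) = 1 := by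
  rw [U_of_det_eq_one (by simp [toMat])]
  simp [toMat, matU_one, ofMatrix_one]

theorem UJ_mul_matU (hp : p ≠ 2) (hK : Fintype.card K = p ^ n) (F : Matrix (Fin 2) (Fin 2) K) :
    UJ K * ofMatrix (matU p n F) = ofMatrix (matU p n (J K * F * J K)) * UJ K := by
  rw [UJ_mul_ofMatrix, map_conj_matU hp hK]

theorem U_mul (hp : p ≠ 2) (hK : Fintype.card K = p ^ n) (F G : ESL K) :
    U p n F * U p n G = U p n (F * G) := by
  have hm : toMat (F * G) = toMat F * toMat G := rfl
  have hdet : (toMat (F * G)).det = (toMat F).det * (toMat G).det := by rw [hm, Matrix.det_mul]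
  rcases det_toMat F with hF | hF <;> rcases det_toMat G with hG | hG <;> rw [hF, hG] at hdet
  · rw [U_of_det_eq_one hF, U_of_det_eq_one hG, U_of_det_eq_one (by rw [hdet, one_mul]),
      ← ofMatrix_mul, matU_mul hp hK hF hG, hm]
  · rw [U_of_det_eq_one hF, U_of_det_eq_neg_one hp hG,
      U_of_det_eq_neg_one hp (by rw [hdet, one_mul]), ← mul_assoc, ← ofMatrix_mul,
      matU_mul hp hK hF (det_mul_J hG), hm, mul_assoc (toMat F)]
  · rw [U_of_det_eq_neg_one hp hF, U_of_det_eq_one hG,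
      U_of_det_eq_neg_one hp (by rw [hdet, mul_one]), mul_assoc, UJ_mul_matU hp hK, ← mul_assoc,
      ← ofMatrix_mul, matU_mul hp hK (det_mul_J hF) (det_mul_J (by simp [hG, det_J])), hm]
    congr 3
    calc toMat F * J K * (J K * toMat G * J K)
        = toMat F * (J K * J K) * toMat G * J K := by simp only [mul_assoc]
      _ = toMat F * toMat G * J K := by rw [J_mul_J, mul_one]
  · rw [U_of_det_eq_neg_one hp hF, U_of_det_eq_neg_one hp hG,
      U_of_det_eq_one (by rw [hdet, neg_one_mul, neg_neg]), mul_assoc, ← mul_assoc (UJ K),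
      UJ_mul_matU hp hK, mul_assoc _ (UJ K), UJ_mul_UJ, mul_one, ← ofMatrix_mul,
      matU_mul hp hK (det_mul_J hF) (det_mul_J (by simp [hG, det_J])), hm]
    congr 2
    calc toMat F * J K * (J K * (toMat G * J K) * J K)
        = toMat F * (J K * J K) * toMat G * (J K * J K) := by simp only [mul_assoc]
      _ = toMat F * toMat G := by rw [J_mul_J, mul_one, mul_one]

theorem U_mul_U_inv (hp : p ≠ 2) (hK : Fintype.card K = p ^ n) (F : ESL K) :
    U p n F * U p n F⁻¹ = 1 := by
  rw [U_mul hp hK, mul_inv_cancel, U_one]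

theorem dagger_ofMatrix_matU_mul (hp : p ≠ 2) (hK : Fintype.card K = p ^ n)
    {F : Matrix (Fin 2) (Fin 2) K} (hF : F.det = 1) :
    dagger (ofMatrix (matU p n F)) * ofMatrix (matU p n F) = 1 := by
  rw [dagger_ofMatrix, conjTranspose_matU hp hK hF, ← ofMatrix_mul,
    matU_mul hp hK (by rw [Matrix.det_adjugate, hF, one_pow]) hF, Matrix.adjugate_mul, hF, one_smul,
    matU_one, ofMatrix_one]

theorem dagger_U_mul_U (hp : p ≠ 2) (hK : Fintype.card K = p ^ n) (F : ESL K) :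
    dagger (U p n F) * U p n F = 1 := by
  rcases det_toMat F with hF | hF
  · rw [U_of_det_eq_one hF, dagger_ofMatrix_matU_mul hp hK hF]
  · rw [U_of_det_eq_neg_one hp hF, dagger_mul, mul_assoc, ← mul_assoc (dagger (ofMatrix _)),
      dagger_ofMatrix_matU_mul hp hK (det_mul_J hF), one_mul, dagger_UJ,
      UJ_mul_UJ]

theorem U_inv (hp : p ≠ 2) (hK : Fintype.card K = p ^ n) (F : ESL K) :
    U p n F⁻¹ = dagger (U p n F) := by
  rw [← mul_one (dagger _), ← U_mul_U_inv hp hK F, ← mul_assoc, dagger_U_mul_U hp hK, one_mul]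

theorem U_mul_D (hp : p ≠ 2) (F : ESL K) (u : Fin 2 → K) :
    U p n F * D p u = D p ((toMat F).mulVec u) * U p n F := by
  rcases det_toMat F with hF | hF
  · rw [U_of_det_eq_one hF, D_eq, D_eq, ← ofMatrix_mul, ← ofMatrix_mul, matU_mul_matD hp hF]
  · rw [U_of_det_eq_neg_one hp hF, D_eq, D_eq, mul_assoc, UJ_mul_ofMatrix, map_conj_matD hp,
      ← mul_assoc, ← ofMatrix_mul, matU_mul_matD hp (det_mul_J hF),
      ofMatrix_mul, mul_assoc, Matrix.mulVec_mulVec, mul_assoc (toMat F), J_mul_J, mul_one]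

end Group

end GaloisClifford

theorem mainTheorem1 (p n : ℕ) [Fact p.Prime] (hp : p ≠ 2)
    (K : Type*) [Field K] [Fintype K] [DecidableEq K] [Algebra (ZMod p) K]
    (hK : Fintype.card K = p ^ n) :
    (∀ F : GaloisClifford.ESL K,
      (((F : Matrix.GeneralLinearGroup (Fin 2) K) : Matrix (Fin 2) (Fin 2) K).det = 1 →
        GaloisClifford.IsUnitaryOp (GaloisClifford.U p n F)) ∧
      (((F : Matrix.GeneralLinearGroup (Fin 2) K) : Matrix (Fin 2) (Fin 2) K).det = -1 →
        GaloisClifford.IsAntiUnitaryOp (GaloisClifford.U p n F))) ∧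
    (∀ (F : GaloisClifford.ESL K) (u : Fin 2 → K),
      GaloisClifford.U p n F * GaloisClifford.D p u *
          GaloisClifford.dagger (GaloisClifford.U p n F) =
        GaloisClifford.D p (Matrix.mulVec
          ((F : Matrix.GeneralLinearGroup (Fin 2) K) : Matrix (Fin 2) (Fin 2) K) u)) ∧
    (∀ F F' : GaloisClifford.ESL K,
      GaloisClifford.U p n F * GaloisClifford.U p n F' = GaloisClifford.U p n (F * F')) ∧
    (∀ F : GaloisClifford.ESL K,
      GaloisClifford.U p n F⁻¹ = GaloisClifford.dagger (GaloisClifford.U p n F)) := by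
  refine ⟨fun F => ⟨fun hF => ?_, fun hF => ?_⟩, fun F u => ?_,
    GaloisClifford.U_mul hp hK, GaloisClifford.U_inv hp hK⟩
  · refine GaloisClifford.isUnitaryOp_of_dagger_mul (fun c ψ => ?_)
      (GaloisClifford.dagger_U_mul_U hp hK F) (GaloisClifford.U_mul_U_inv hp hK F)
    rw [GaloisClifford.U_of_det_eq_one hF, GaloisClifford.ofMatrix_smul]
  · refine GaloisClifford.isAntiUnitaryOp_of_dagger_mul (fun c ψ => ?_)
      (GaloisClifford.dagger_U_mul_U hp hK F) (GaloisClifford.U_mul_U_inv hp hK F)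
    rw [GaloisClifford.U_of_det_eq_neg_one hp hF, Module.End.mul_apply, Module.End.mul_apply,
      GaloisClifford.UJ_smul, GaloisClifford.ofMatrix_smul]
  · rw [GaloisClifford.U_mul_D hp, mul_assoc, ← GaloisClifford.U_inv hp hK,
      GaloisClifford.U_mul_U_inv hp hK, mul_one]
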